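/- Let $\mathbb{A}$ be a finite-dimensional real alternative $*$-algebra with unity, i.e. a unital real algebra whose associator $[a,b,c]=(ab)c-a(bc)$ is alternating, with a real-linear anti-involution $a\mapsto a^c$, equipped with its natural topology as a real vector space. Put $t(x)=x+x^c$, $n(x)=xx^c$, $\mathbb{S}_{\mathbb A}=\{x: t(x)=0,\ n(x)=1\}$ and $Q_{\mathbb A}=\mathbb{R}\cup\{x: t(x)\in\mathbb{R},\ n(x)\in\mathbb{R},\ 4n(x)>t(x)^2\}$. Let $M$ be a real subspace with $\mathbb{R}\subsetneq M\subseteq Q_{\mathbb A}$ and let $\mathcal{B}=(v_0,\dots,v_m)$, $m\ge 1$, be a hypercomplex basis of $M$: $v_0=1$, $v_s\in\mathbb{S}_{\mathbb A}$ for $s\ge 1$, and $v_sv_t=-v_tv_s$ for distinct $s,t\ge 1$. Complete $\mathcal{B}$ to a real basis $(v_0,\dots,v_d)$ of $\mathbb{A}$, and identify $\mathbb{R}^{m+1}$ with $M$ via $(x_0,\dots,x_m)\mapsto\sum_{s=0}^m x_sv_s$. Let $\Omega\subseteq M$ be a domain (a non-empty connected open set). A function $f=\sum_{t=0}^d f_tv_t:\Omega\to\mathbb{A}$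 with real-valued components $f_t$ of class $C^1$ is called left monogenic on $\Omega$ (with respect to $\mathcal{B}$) if $$\sum_{s=0}^m v_s\frac{\partial f}{\partial x_s}(x)=\sum_{s=0}^m\sum_{t=0}^d v_sv_t\frac{\partial f_t}{\partial x_s}(x)=0\qquad\text{for all }x\in\Omega .$$ Let $N\subseteq\Omega$ be a non-empty $m$-dimensional smooth submanifold (embedded, or more generally the image of a smooth immersion $\iota: N_0\to M$ of a non-empty $m$-dimensional smooth manifold $N_0$). Then: 1. If $f,g:\Omega\to\mathbb{A}$ are left monogenic and $f=g$ on $N$, then $f\equiv g$ on $\Omega$. 2. Equivalently, if $f:\Omega\to\mathbb{A}$ is left monogenic and its zero set $\{x\in\Omega: f(x)=0\}$ contains $N$, then $f\equiv 0$ on $\Omega$. -/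

import Mathlib

open scoped Manifold ContDiff

namespace Hypercomplex

section Algebra

variable {A : Type*} [NonAssocRing A]

/-- A (possibly non-associative) ring is alternative if its associator
`[a, b, c] = (a * b) * c - a * (b * c)` (which is always additive in each variable) is alternating,
i.e. vanishes as soon as two of its arguments coincide. -/
def IsAlternative (A : Type*) [NonAssocRing A] : Prop :=
  ∀ a b : A, associator a a b = 0 ∧ associator a b b = 0 ∧ associator a b a = 0

variable [Module ℝ A] [StarRing A]

/-- The trace `t(x) = x + xᶜ`. -/
def trace (x : A) : A := x + star x

/-- The squared norm `n(x) = x xᶜ`. -/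
def sqNorm (x : A) : A := x * star x

/-- The set of imaginary units of `A`: `t(x) = 0` and `n(x) = 1`. -/
def imaginaryUnits (A : Type*) [NonAssocRing A] [StarRing A] : Set A :=
  {x | trace x = 0 ∧ sqNorm x = 1}

/-- The quadratic cone of `A`; the reals are the multiples of `1`. -/
def quadraticCone (A : Type*) [NonAssocRing A] [Module ℝ A] [StarRing A] : Set A :=
  {x | ∃ r : ℝ, x = r • (1 : A)} ∪
    {x | ∃ a b : ℝ, trace x = a • (1 : A) ∧ sqNorm x = b • (1 : A) ∧ a ^ 2 < 4 * b}

/-- A hypercomplex subspace: a real subspace `M` with `ℝ ⊊ M ⊆ Q_A`. -/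
def IsHypercomplexSubspace (M : Submodule ℝ A) : Prop :=
  Submodule.span ℝ {(1 : A)} < M ∧ (M : Set A) ⊆ quadraticCone A

/-- A hypercomplex basis `(v₀, …, v_m)` of `M`: `m ≥ 1`, `v₀ = 1`, and `v₁, …, v_m` are pairwise
anticommuting imaginary units. -/
structure IsHypercomplexBasis {M : Submodule ℝ A} {m : ℕ}
    (B : Module.Basis (Fin (m + 1)) ℝ M) : Prop where
  one_le : 1 ≤ m
  zero_eq_one : (B 0 : A) = 1
  mem_imaginaryUnits : ∀ s, s ≠ 0 → (B s : A) ∈ imaginaryUnits A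
  anticomm : ∀ s t, s ≠ 0 → t ≠ 0 → s ≠ t → (B s : A) * (B t : A) = -((B t : A) * (B s : A))

end Algebra

section Monogenic

variable {A : Type*} [NonAssocRing A] [Module ℝ A] {M : Submodule ℝ A} {m d : ℕ}

/-- The identification of `ℝ^{m+1}` with `M`, `(x₀, …, x_m) ↦ ∑ s, x_s v_s`. -/
noncomputable def identification (B : Module.Basis (Fin (m + 1)) ℝ M) :
    EuclideanSpace ℝ (Fin (m + 1)) ≃ₗ[ℝ] M :=
  WithLp.linearEquiv 2 ℝ (Fin (m + 1) → ℝ) ≪≫ₗ B.equivFun.symm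

/-- `f ∈ C¹(Ω, A)`: all the components `f_t` of `f = ∑ t, f_t v_t` with respect to the basis `B'`
of `A` are continuously differentiable on `Ω` as functions of the real variables `x₀, …, x_m`. -/
def IsC1On (B : Module.Basis (Fin (m + 1)) ℝ M) (B' : Module.Basis (Fin (d + 1)) ℝ A)
    (f : M → A) (Ω : Set M) : Prop :=
  ∀ t, ContDiffOn ℝ 1 (fun y => B'.coord t (f (identification B y))) (identification B ⁻¹' Ω)

/-- The partial derivative `∂f/∂x_s = ∑ t, (∂f_t/∂x_s) v_t`. Increasing the coordinate `x_s` is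
moving in the direction `v_s`, so `∂f_t/∂x_s (x)` is the derivative at `0` of
`r ↦ f_t (x + r v_s)`. -/
noncomputable def partialDeriv (B : Module.Basis (Fin (m + 1)) ℝ M)
    (B' : Module.Basis (Fin (d + 1)) ℝ A) (s : Fin (m + 1)) (f : M → A) (x : M) : A :=
  ∑ t, lineDeriv ℝ (fun y => B'.coord t (f y)) x (B s) • B' t

/-- The Cauchy-Riemann operator `∑ s, v_s (∂f/∂x_s)` induced by `B`, acting from the left. -/
noncomputable def cauchyRiemann (B : Module.Basis (Fin (m + 1)) ℝ M)
    (B' : Module.Basis (Fin (d + 1)) ℝ A) (f : M → A) (x : M) : A :=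
  ∑ s, (B s : A) * partialDeriv B B' s f x

/-- Left monogenic functions on `Ω` with respect to `B`. -/
def IsLeftMonogenicOn (B : Module.Basis (Fin (m + 1)) ℝ M)
    (B' : Module.Basis (Fin (d + 1)) ℝ A) (f : M → A) (Ω : Set M) : Prop :=
  IsC1On B B' f Ω ∧ ∀ x ∈ Ω, cauchyRiemann B B' f x = 0

/-- The zero set of `f` in `Ω`. -/
def zeroSet (f : M → A) (Ω : Set M) : Set M := {x ∈ Ω | f x = 0}

/-- `ι : N → M` is a smooth immersion of the manifold `N` into `M ≅ ℝ^{m+1}`: it is smooth and its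
differential is injective at every point. The inclusion map of a `k`-dimensional smooth
submanifold, embedded or immersed, is of this kind. -/
structure IsSmoothImmersion (B : Module.Basis (Fin (m + 1)) ℝ M) (k : ℕ) {N : Type*}
    [TopologicalSpace N] [ChartedSpace (EuclideanSpace ℝ (Fin k)) N] (ι : N → M) : Prop where
  contMDiff : ContMDiff (𝓡 k) (𝓡 (m + 1)) ∞ (fun p => (identification B).symm (ι p))
  injective_mfderiv : ∀ p, Function.Injective
    (mfderiv (𝓡 k) (𝓡 (m + 1)) (fun p => (identification B).symm (ι p)) p)

end Monogenic

end Hypercomplex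

namespace Hypercomplex

open MeasureTheory Metric Set Filter Topology

section Mollifier

variable {n : ℕ}

/-- A smooth radial function supported in the closed unit ball, with integral one. -/
structure IsRadialMollifier (φ : EuclideanSpace ℝ (Fin n) → ℝ) : Prop where
  contDiff : ContDiff ℝ ∞ φ
  eq_zero : ∀ y, 1 ≤ ‖y‖ → φ y = 0
  integral_eq_one : ∫ y, φ y = 1
  radial : ∀ y s t, y t * fderiv ℝ φ y (EuclideanSpace.single s 1) =
    y s * fderiv ℝ φ y (EuclideanSpace.single t 1)

theorem IsRadialMollifier.hasCompactSupport {φ : EuclideanSpace ℝ (Fin n) → ℝ}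
    (hφ : IsRadialMollifier φ) : HasCompactSupport φ := by
  refine HasCompactSupport.intro (isCompact_closedBall (0 : EuclideanSpace ℝ (Fin n)) 1) ?_
  intro y hy
  refine hφ.eq_zero y ?_
  simp only [mem_closedBall, dist_zero_right, not_le] at hy
  exact hy.le

theorem exists_isRadialMollifier (n : ℕ) :
    ∃ φ : EuclideanSpace ℝ (Fin n) → ℝ, IsRadialMollifier φ := by
  set g : EuclideanSpace ℝ (Fin n) → ℝ := fun y => expNegInvGlue (1 - ‖y‖ ^ 2) with hg
  have hsm : ContDiff ℝ ∞ g :=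
    (expNegInvGlue.contDiff (n := ⊤)).comp (contDiff_const.sub (contDiff_norm_sq ℝ))
  have hz : ∀ y, 1 ≤ ‖y‖ → g y = 0 := fun y hy =>
    expNegInvGlue.zero_of_nonpos (by nlinarith)
  have hcs : HasCompactSupport g := by
    refine HasCompactSupport.intro (isCompact_closedBall (0 : EuclideanSpace ℝ (Fin n)) 1) ?_
    intro y hy
    refine hz y ?_
    simp only [mem_closedBall, dist_zero_right, not_le] at hy
    exact hy.le
  have hpos : 0 < ∫ y, g y := by
    refine hsm.continuous.integral_pos_of_hasCompactSupport_nonneg_nonzero hcs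
      (fun y => expNegInvGlue.nonneg _) (x := 0) ?_
    have : 0 < g 0 := expNegInvGlue.pos_of_pos (by simp)
    exact this.ne'
  have hd : ∀ y v, fderiv ℝ g y v = -(deriv expNegInvGlue (1 - ‖y‖ ^ 2) * (2 * inner ℝ y v)) := by
    intro y v
    have h1 : HasDerivAt expNegInvGlue (deriv expNegInvGlue (1 - ‖y‖ ^ 2)) (1 - ‖y‖ ^ 2) :=
      ((expNegInvGlue.contDiff (n := 1)).differentiable (by simp) _).hasDerivAt
    have h2 : HasFDerivAt (fun y : EuclideanSpace ℝ (Fin n) => 1 - ‖y‖ ^ 2)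
        (-(2 • innerSL ℝ y)) y := ((hasStrictFDerivAt_norm_sq y).hasFDerivAt).const_sub 1
    have h3 : HasFDerivAt (expNegInvGlue ∘ fun y : EuclideanSpace ℝ (Fin n) => 1 - ‖y‖ ^ 2) _ y :=
      h1.comp_hasFDerivAt y h2
    have h4 : fderiv ℝ g y = _ := h3.fderiv
    rw [h4]
    simp
  set c := ∫ y, g y with hc
  refine ⟨fun y => c⁻¹ * g y, contDiff_const.mul hsm, fun y hy => by simp [hz y hy], ?_, ?_⟩
  · rw [integral_const_mul, ← hc, inv_mul_cancel₀ hpos.ne']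
  · intro y s t
    have : ∀ v, fderiv ℝ (fun y => c⁻¹ * g y) y v = c⁻¹ * fderiv ℝ g y v := by
      intro v
      rw [fderiv_const_mul (hsm.differentiable (by simp) y)]
      simp
    rw [this, this, hd, hd]
    simp only [EuclideanSpace.inner_single_right]
    simp
    ring

variable {V : Type*} [NormedAddCommGroup V] [NormedSpace ℝ V]

/-- A radial mollifier annihilates the infinitesimal rotations of a `C¹` function. -/
theorem IsRadialMollifier.integral_rotation_eq_zero {φ : EuclideanSpace ℝ (Fin n) → ℝ}
    (hφ : IsRadialMollifier φ) {g : EuclideanSpace ℝ (Fin n) → V} (hg : ContDiff ℝ 1 g)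
    (s t : Fin n) :
    ∫ y, φ y • (y t • fderiv ℝ g y (EuclideanSpace.single s 1) -
      y s • fderiv ℝ g y (EuclideanSpace.single t 1)) = 0 := by
  have hcoord : ∀ t : Fin n, ContDiff ℝ ∞ (fun y : EuclideanSpace ℝ (Fin n) => y t) :=
    fun t => (EuclideanSpace.proj t : EuclideanSpace ℝ (Fin n) →L[ℝ] ℝ).contDiff
  have hψ : ∀ t : Fin n, ContDiff ℝ ∞ (fun y : EuclideanSpace ℝ (Fin n) => φ y * y t) :=
    fun t => hφ.contDiff.mul (hcoord t)
  have hψc : ∀ t : Fin n, HasCompactSupport (fun y : EuclideanSpace ℝ (Fin n) => φ y * y t) :=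
    fun t => hφ.hasCompactSupport.mul_right
  have hgd : ∀ v, Continuous fun y => fderiv ℝ g y v := fun v =>
    (hg.continuous_fderiv (by simp)).clm_apply continuous_const
  have hψd : ∀ t v, Continuous fun y =>
      fderiv ℝ (fun y : EuclideanSpace ℝ (Fin n) => φ y * y t) y v := fun t v =>
    ((hψ t).continuous_fderiv (by simp)).clm_apply continuous_const
  have hi : ∀ t v, Integrable fun y : EuclideanSpace ℝ (Fin n) =>
      (φ y * y t) • fderiv ℝ g y v := fun t v =>
    ((hψ t).continuous.smul (hgd v)).integrable_of_hasCompactSupport (hψc t).smul_right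
  have hi2 : ∀ t v, Integrable fun y : EuclideanSpace ℝ (Fin n) =>
      fderiv ℝ (fun y : EuclideanSpace ℝ (Fin n) => φ y * y t) y v • g y := fun t v =>
    ((hψd t v).smul hg.continuous).integrable_of_hasCompactSupport
      (((hψc t).fderiv_apply ℝ v).smul_right)
  have hi3 : ∀ t, Integrable fun y : EuclideanSpace ℝ (Fin n) =>
      (φ y * y t) • g y := fun t =>
    ((hψ t).continuous.smul hg.continuous).integrable_of_hasCompactSupport (hψc t).smul_right
  have hibp : ∀ t v, ∫ y : EuclideanSpace ℝ (Fin n), (φ y * y t) • fderiv ℝ g y v =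
      -∫ y, fderiv ℝ (fun y : EuclideanSpace ℝ (Fin n) => φ y * y t) y v • g y := fun t v =>
    integral_smul_fderiv_eq_neg_fderiv_smul_of_integrable (hi2 t v) (hi t v) (hi3 t)
      (fun x _ => (hψ t).differentiable (by simp) x) (fun x _ => hg.differentiable (by simp) x)
  have hsym : ∀ y : EuclideanSpace ℝ (Fin n),
      fderiv ℝ (fun y : EuclideanSpace ℝ (Fin n) => φ y * y t) y (EuclideanSpace.single s 1) =
      fderiv ℝ (fun y : EuclideanSpace ℝ (Fin n) => φ y * y s) y (EuclideanSpace.single t 1) := by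
    intro y
    have h1 : ∀ t : Fin n, HasFDerivAt (fun y : EuclideanSpace ℝ (Fin n) => y t)
        (EuclideanSpace.proj t : EuclideanSpace ℝ (Fin n) →L[ℝ] ℝ) y :=
      fun t => (EuclideanSpace.proj t : EuclideanSpace ℝ (Fin n) →L[ℝ] ℝ).hasFDerivAt
    have h2 := (hφ.contDiff.differentiable (by simp) y).hasFDerivAt
    have h3 : ∀ t : Fin n, HasFDerivAt (fun y : EuclideanSpace ℝ (Fin n) => φ y * y t) _ y :=
      fun t => h2.mul (h1 t)
    rw [(h3 t).fderiv, (h3 s).fderiv]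
    have := hφ.radial y s t
    have h4 : (EuclideanSpace.proj t : EuclideanSpace ℝ (Fin n) →L[ℝ] ℝ)
        (EuclideanSpace.single s 1) = (EuclideanSpace.proj s : EuclideanSpace ℝ (Fin n) →L[ℝ] ℝ)
        (EuclideanSpace.single t 1) := by
      simp [eq_comm]
    simp only [add_apply, smul_apply, smul_eq_mul, this, h4]
  calc _ = ∫ y, ((φ y * y t) • fderiv ℝ g y (EuclideanSpace.single s 1) -
      (φ y * y s) • fderiv ℝ g y (EuclideanSpace.single t 1)) := by
        simp only [smul_sub, smul_smul]
    _ = 0 := by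
        rw [integral_sub (hi _ _) (hi _ _), hibp, hibp]
        simp only [hsym]
        simp

end Mollifier

section CauchyRiemann

variable {n : ℕ} {V : Type*} [NormedAddCommGroup V] [NormedSpace ℝ V]

/-- The constant coefficient operator `∑ s, L s (∂f/∂x_s)`. -/
noncomputable def dirac (L : Fin n → V →L[ℝ] V) (f : EuclideanSpace ℝ (Fin n) → V)
    (x : EuclideanSpace ℝ (Fin n)) : V :=
  ∑ s, L s (fderiv ℝ f x (EuclideanSpace.single s 1))

/-- `L'` is a conjugate system of `L`: the operator `∑ s, L' s ∂_s` factors the Laplacian through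
`∑ s, L s ∂_s`. -/
def IsConjugateSystem (L' L : Fin n → V →L[ℝ] V) : Prop :=
  ∀ s t a, L' s (L t a) + L' t (L s a) = if s = t then (2 : ℝ) • a else 0

variable {L L' : Fin n → V →L[ℝ] V}

theorem euclidean_eq_sum_single (y : EuclideanSpace ℝ (Fin n)) :
    y = ∑ s, y s • EuclideanSpace.single s (1 : ℝ) := by
  ext i
  simp [Pi.single_apply]

theorem apply_eq_sum_single (T : EuclideanSpace ℝ (Fin n) →L[ℝ] V) (y : EuclideanSpace ℝ (Fin n)) :
    T y = ∑ s, y s • T (EuclideanSpace.single s 1) := by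
  conv_lhs => rw [euclidean_eq_sum_single y]
  simp

/-- The radial derivative of a solution is a combination of infinitesimal rotations. -/
theorem IsConjugateSystem.radial_eq (h : IsConjugateSystem L' L)
    {f : EuclideanSpace ℝ (Fin n) → V} {x : EuclideanSpace ℝ (Fin n)} (hf : dirac L f x = 0)
    (y : EuclideanSpace ℝ (Fin n)) :
    fderiv ℝ f x y = (2⁻¹ : ℝ) • ∑ s, ∑ t, L' s (L t
      (y t • fderiv ℝ f x (EuclideanSpace.single s 1) -
        y s • fderiv ℝ f x (EuclideanSpace.single t 1))) := by
  set D : Fin n → V := fun s => fderiv ℝ f x (EuclideanSpace.single s 1) with hD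
  have hf' : ∑ t, L t (D t) = 0 := hf
  have h1 : ∑ s, ∑ t, y s • L' s (L t (D t)) = 0 := by
    have : ∀ s, ∑ t, y s • L' s (L t (D t)) = 0 := fun s => by
      rw [← Finset.smul_sum, ← map_sum, hf']; simp
    simp [this]
  have h2 : ∑ s, ∑ t, y t • (L' s (L t (D s)) + L' t (L s (D s))) = (2 : ℝ) • fderiv ℝ f x y := by
    rw [apply_eq_sum_single (fderiv ℝ f x) y, Finset.smul_sum]
    refine Finset.sum_congr rfl fun s _ => ?_
    simp only [h s _ (D s)]
    simp only [smul_ite, smul_zero, Finset.sum_ite_eq, Finset.mem_univ, if_true, hD]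
    rw [smul_comm]
  have h3 : ∑ s, ∑ t, y t • L' t (L s (D s)) = 0 := by
    rw [Finset.sum_comm]; exact h1
  simp only [smul_add, Finset.sum_add_distrib, h3, add_zero] at h2
  simp only [map_sub, map_smul, Finset.sum_sub_distrib]
  rw [h1, sub_zero, h2, smul_smul]
  norm_num

theorem IsConjugateSystem.integral_radial_eq_zero [CompleteSpace V] (h : IsConjugateSystem L' L)
    {φ : EuclideanSpace ℝ (Fin n) → ℝ} (hφ : IsRadialMollifier φ)
    {g : EuclideanSpace ℝ (Fin n) → V} (hg : ContDiff ℝ 1 g)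
    (hgd : ∀ y ∈ ball (0 : EuclideanSpace ℝ (Fin n)) 1, dirac L g y = 0) :
    ∫ y, φ y • fderiv ℝ g y y = 0 := by
  have hcont : ∀ s t : Fin n, Continuous fun y : EuclideanSpace ℝ (Fin n) =>
      φ y • (y t • fderiv ℝ g y (EuclideanSpace.single s 1) -
        y s • fderiv ℝ g y (EuclideanSpace.single t 1)) := by
    intro s t
    have hd : ∀ v, Continuous fun y => fderiv ℝ g y v := fun v =>
      (hg.continuous_fderiv (by simp)).clm_apply continuous_const
    have hy : ∀ t : Fin n, Continuous fun y : EuclideanSpace ℝ (Fin n) => y t := fun t =>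
      (EuclideanSpace.proj t : EuclideanSpace ℝ (Fin n) →L[ℝ] ℝ).continuous
    exact hφ.contDiff.continuous.smul (((hy t).smul (hd _)).sub ((hy s).smul (hd _)))
  have hint : ∀ s t : Fin n, Integrable fun y : EuclideanSpace ℝ (Fin n) =>
      φ y • (y t • fderiv ℝ g y (EuclideanSpace.single s 1) -
        y s • fderiv ℝ g y (EuclideanSpace.single t 1)) := fun s t =>
    (hcont s t).integrable_of_hasCompactSupport hφ.hasCompactSupport.smul_right
  have hrw : ∀ y, φ y • fderiv ℝ g y y = (2⁻¹ : ℝ) • ∑ s, ∑ t, ((L' s).comp (L t))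
      (φ y • (y t • fderiv ℝ g y (EuclideanSpace.single s 1) -
        y s • fderiv ℝ g y (EuclideanSpace.single t 1))) := by
    intro y
    by_cases hy : y ∈ ball (0 : EuclideanSpace ℝ (Fin n)) 1
    · rw [h.radial_eq (hgd y hy) y]
      simp only [map_smul, ContinuousLinearMap.comp_apply, ← Finset.smul_sum]
      rw [smul_comm]
    · have : φ y = 0 := hφ.eq_zero y (by simpa using hy)
      simp [this]
  simp only [hrw]
  rw [integral_smul, integral_finsetSum _ fun s _ => integrable_finsetSum _ fun t _ =>
    ((L' s).comp (L t)).integrable_comp (hint s t)]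
  have : ∀ s, ∫ y : EuclideanSpace ℝ (Fin n), ∑ t, ((L' s).comp (L t))
      (φ y • (y t • fderiv ℝ g y (EuclideanSpace.single s 1) -
        y s • fderiv ℝ g y (EuclideanSpace.single t 1))) = 0 := by
    intro s
    rw [integral_finsetSum _ fun t _ => ((L' s).comp (L t)).integrable_comp (hint s t)]
    refine Finset.sum_eq_zero fun t _ => ?_
    rw [ContinuousLinearMap.integral_comp_comm _ (hint s t), hφ.integral_rotation_eq_zero hg,
      map_zero]
  rw [Finset.sum_eq_zero fun s _ => this s, smul_zero]

/-- The mean value property of solutions. -/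
theorem IsConjugateSystem.mean_value [CompleteSpace V] (h : IsConjugateSystem L' L)
    {φ : EuclideanSpace ℝ (Fin n) → ℝ} (hφ : IsRadialMollifier φ)
    {f : EuclideanSpace ℝ (Fin n) → V} (hf : ContDiff ℝ 1 f)
    {x : EuclideanSpace ℝ (Fin n)} {R : ℝ} (hR : 0 ≤ R)
    (hfd : ∀ z ∈ closedBall x R, dirac L f z = 0) :
    f x = ∫ y, φ y • f (x + R • y) := by
  set F : ℝ → V := fun r => ∫ y, φ y • f (x + r • y) with hF
  have hcf : Continuous (fderiv ℝ f) := hf.continuous_fderiv (by simp)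
  obtain ⟨C, hC⟩ : ∃ C, ∀ z ∈ closedBall x (R + 1), ‖fderiv ℝ f z‖ ≤ C :=
    (isCompact_closedBall x (R + 1)).exists_bound_of_continuousOn hcf.continuousOn
  have hmem : ∀ r ∈ Icc (0 : ℝ) R, ∀ ρ ∈ ball r 1, ∀ y : EuclideanSpace ℝ (Fin n), ‖y‖ ≤ 1 →
      x + ρ • y ∈ closedBall x (R + 1) := by
    intro r hr ρ hρ y hy
    simp only [mem_closedBall, dist_self_add_left, norm_smul, Real.norm_eq_abs]
    have h1 : |ρ| ≤ R + 1 := by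
      rw [mem_ball, Real.dist_eq, abs_lt] at hρ
      rw [abs_le]; constructor <;> linarith [hr.1, hr.2]
    nlinarith [abs_nonneg ρ, norm_nonneg y]
  have hFd : ∀ r ∈ Icc (0 : ℝ) R, HasDerivAt F (∫ y, φ y • fderiv ℝ f (x + r • y) y) r := by
    intro r hr
    have hcont : ∀ r : ℝ, Continuous fun y => φ y • f (x + r • y) := fun r =>
      hφ.contDiff.continuous.smul (hf.continuous.comp (by fun_prop))
    have hcont' : Continuous fun y => φ y • fderiv ℝ f (x + r • y) y :=
      hφ.contDiff.continuous.smul ((hcf.comp (by fun_prop)).clm_apply continuous_id)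
    refine (hasDerivAt_integral_of_dominated_loc_of_deriv_le (s := ball r 1)
      (bound := fun y => |φ y| * C) (ball_mem_nhds r one_pos)
      (Eventually.of_forall fun r => (hcont r).aestronglyMeasurable)
      ((hcont r).integrable_of_hasCompactSupport hφ.hasCompactSupport.smul_right)
      (F' := fun ρ y => φ y • fderiv ℝ f (x + ρ • y) y)
      hcont'.aestronglyMeasurable ?_ ?_ ?_).2
    · refine Eventually.of_forall fun y ρ hρ => ?_
      rw [norm_smul, Real.norm_eq_abs]
      rcases le_or_gt 1 ‖y‖ with hy | hy
      · simp [hφ.eq_zero y hy]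
      · have h1 := hC _ (hmem r hr ρ hρ y hy.le)
        have h2 := (fderiv ℝ f (x + ρ • y)).le_opNorm y
        have : ‖fderiv ℝ f (x + ρ • y) y‖ ≤ C := by
          nlinarith [norm_nonneg (fderiv ℝ f (x + ρ • y)), norm_nonneg y]
        exact mul_le_mul_of_nonneg_left this (abs_nonneg _)
    · exact ((hφ.contDiff.continuous.integrable_of_hasCompactSupport
        hφ.hasCompactSupport).abs).mul_const C
    · refine Eventually.of_forall fun y ρ _ => ?_
      have h1 : HasDerivAt (fun ρ : ℝ => x + ρ • y) y ρ := by
        simpa using ((hasDerivAt_id ρ).smul_const y).const_add x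
      exact ((hf.differentiable (by simp) _).hasFDerivAt.comp_hasDerivAt ρ h1).const_smul (φ y)
  have hF0 : ∀ r ∈ Icc (0 : ℝ) R, ∫ y, φ y • fderiv ℝ f (x + r • y) y = 0 := by
    intro r hr
    rcases eq_or_lt_of_le hr.1 with h0 | h0
    · subst h0
      have := h.integral_radial_eq_zero hφ (g := fderiv ℝ f x)
        (fderiv ℝ f x).contDiff (fun y _ => by
          simpa [dirac] using hfd x (mem_closedBall_self hR))
      simpa using this
    · have hg : ContDiff ℝ 1 fun y => f (x + r • y) := hf.comp (by fun_prop)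
      have hgd : ∀ y v, fderiv ℝ (fun y => f (x + r • y)) y v = r • fderiv ℝ f (x + r • y) v := by
        intro y v
        have h1 : HasFDerivAt (fun y : EuclideanSpace ℝ (Fin n) => x + r • y)
            (r • ContinuousLinearMap.id ℝ _) y :=
          ((hasFDerivAt_id y).const_smul r).const_add x
        have h2 := (hf.differentiable (by simp) (x + r • y)).hasFDerivAt.comp y h1
        have h3 : fderiv ℝ (fun y => f (x + r • y)) y = _ := h2.fderiv
        rw [h3]
        simp
      have := h.integral_radial_eq_zero hφ hg (fun y hy => by
        have hz : dirac L f (x + r • y) = 0 := by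
          refine hfd _ ?_
          simp only [mem_closedBall, dist_self_add_left, norm_smul, Real.norm_eq_abs,
            abs_of_pos h0]
          simp only [mem_ball, dist_zero_right] at hy
          nlinarith [hr.2]
        simp only [dirac, hgd, map_smul, ← Finset.smul_sum]
        rw [dirac] at hz
        rw [hz, smul_zero])
      simp only [hgd, smul_comm _ r, integral_smul] at this
      exact (smul_eq_zero.1 this).resolve_left h0.ne'
  have hconst := constant_of_derivWithin_zero (f := F) (a := 0) (b := R)
    (fun r hr => (hFd r hr).differentiableAt.differentiableWithinAt)
    (fun r hr => by
      have hr' : r ∈ Icc (0 : ℝ) R := ⟨hr.1, hr.2.le⟩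
      rw [((hFd r hr').hasDerivWithinAt).derivWithin
        (uniqueDiffOn_Icc (hr.1.trans_lt hr.2) r hr'), hF0 r hr'])
    R ⟨hR, le_rfl⟩
  have h00 : F 0 = f x := by
    simp [hF, integral_smul_const, hφ.integral_eq_one]
  rw [← h00, ← hconst]

end CauchyRiemann

section Regularity

variable {n : ℕ} {V : Type*} [NormedAddCommGroup V] [NormedSpace ℝ V]

theorem exists_contDiff_hasCompactSupport_eventuallyEq {k : ℕ∞}
    {f : EuclideanSpace ℝ (Fin n) → V} {x : EuclideanSpace ℝ (Fin n)} {r R : ℝ} (hr : 0 < r)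
    (hrR : r < R) (hf : ContDiffOn ℝ k f (ball x R)) :
    ∃ g : EuclideanSpace ℝ (Fin n) → V, ContDiff ℝ k g ∧ HasCompactSupport g ∧
      ∀ z ∈ closedBall x r, g =ᶠ[𝓝 z] f := by
  let χ : ContDiffBump x := ⟨(2 * r + R) / 3, (r + 2 * R) / 3, by linarith, by linarith⟩
  have hsub : tsupport χ ⊆ ball x R := by
    rw [χ.tsupport_eq]
    exact closedBall_subset_ball (by change (r + 2 * R) / 3 < R; linarith)
  refine ⟨fun z => χ z • f z, ?_, χ.hasCompactSupport.smul_right, ?_⟩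
  · refine contDiff_iff_contDiffAt.2 fun z => ?_
    by_cases hz : z ∈ tsupport χ
    · exact χ.contDiffAt.smul (hf.contDiffAt (isOpen_ball.mem_nhds (hsub hz)))
    · refine (contDiffAt_const (c := (0 : V))).congr_of_eventuallyEq ?_
      filter_upwards [notMem_tsupport_iff_eventuallyEq.1 hz] with w hw
      simp [hw]
  · intro z hz
    have hz' : z ∈ ball x ((2 * r + R) / 3) :=
      closedBall_subset_ball (by linarith) hz
    filter_upwards [isOpen_ball.mem_nhds hz'] with w hw
    rw [χ.one_of_mem_closedBall (ball_subset_closedBall hw), one_smul]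

theorem IsRadialMollifier.contDiff_integral_smul [CompleteSpace V]
    {φ : EuclideanSpace ℝ (Fin n) → ℝ} (hφ : IsRadialMollifier φ)
    {g : EuclideanSpace ℝ (Fin n) → V} (hg : Continuous g) {ρ : ℝ} (hρ : ρ ≠ 0) :
    ContDiff ℝ ∞ fun x => ∫ y, φ y • g (x + ρ • y) := by
  set ψ : EuclideanSpace ℝ (Fin n) → ℝ := fun z => φ ((-ρ)⁻¹ • z) with hψ
  have hψs : ContDiff ℝ ∞ ψ := hφ.contDiff.comp (by fun_prop)
  have hψc : HasCompactSupport ψ := hφ.hasCompactSupport.comp_smul (by simpa using hρ)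
  have hconv := hψc.contDiff_convolution_left (μ := volume) (n := ⊤)
    (ContinuousLinearMap.lsmul ℝ ℝ) hψs (hg.locallyIntegrable (μ := volume))
  have heq : (fun x => ∫ y, φ y • g (x + ρ • y)) = fun x =>
      |((-ρ) ^ Module.finrank ℝ (EuclideanSpace ℝ (Fin n)))⁻¹| •
        (convolution ψ g (ContinuousLinearMap.lsmul ℝ ℝ) volume x) := by
    funext x
    have := Measure.integral_comp_smul (volume : Measure (EuclideanSpace ℝ (Fin n)))
      (fun z => ψ z • g (x - z)) (-ρ)
    rw [convolution_def]
    simp only [ContinuousLinearMap.lsmul_apply]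
    rw [← this]
    refine integral_congr_ae (Eventually.of_forall fun y => ?_)
    simp only [hψ]
    rw [smul_smul, inv_mul_cancel₀ (neg_ne_zero.2 hρ), one_smul, neg_smul, sub_neg_eq_add]
  rw [heq]
  exact contDiff_const.smul hconv

/-- Smooth solutions of the equation `dirac L f = 0` on `U`. -/
def IsSmoothSolutionOn (L : Fin n → V →L[ℝ] V) (f : EuclideanSpace ℝ (Fin n) → V)
    (U : Set (EuclideanSpace ℝ (Fin n))) : Prop :=
  ContDiffOn ℝ ∞ f U ∧ ∀ x ∈ U, dirac L f x = 0

variable {L L' : Fin n → V →L[ℝ] V}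

theorem IsSmoothSolutionOn.mono {f : EuclideanSpace ℝ (Fin n) → V}
    {U W : Set (EuclideanSpace ℝ (Fin n))} (h : IsSmoothSolutionOn L f U) (hW : W ⊆ U) :
    IsSmoothSolutionOn L f W :=
  ⟨h.1.mono hW, fun x hx => h.2 x (hW hx)⟩

theorem dirac_congr {f g : EuclideanSpace ℝ (Fin n) → V} {x : EuclideanSpace ℝ (Fin n)}
    (h : f =ᶠ[𝓝 x] g) : dirac L f x = dirac L g x := by
  simp only [dirac, h.fderiv_eq]

/-- Solutions of class `C¹` are smooth. -/
theorem IsConjugateSystem.isSmoothSolutionOn [CompleteSpace V] (h : IsConjugateSystem L' L)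
    {f : EuclideanSpace ℝ (Fin n) → V} {U : Set (EuclideanSpace ℝ (Fin n))} (hU : IsOpen U)
    (hf : ContDiffOn ℝ 1 f U) (hfd : ∀ x ∈ U, dirac L f x = 0) : IsSmoothSolutionOn L f U := by
  refine ⟨fun x hx => ContDiffAt.contDiffWithinAt ?_, hfd⟩
  obtain ⟨φ, hφ⟩ := exists_isRadialMollifier n
  obtain ⟨R, hR, hRU⟩ := Metric.isOpen_iff.1 hU x hx
  obtain ⟨g, hg, -, hgf⟩ := exists_contDiff_hasCompactSupport_eventuallyEq (k := 1)
    (half_pos hR) (half_lt_self hR) (hf.mono hRU)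
  have heq : f =ᶠ[𝓝 x] fun x => ∫ y, φ y • g (x + (R / 4) • y) := by
    filter_upwards [ball_mem_nhds x (show 0 < R / 4 by linarith)] with z hz
    have hsub : closedBall z (R / 4) ⊆ closedBall x (R / 2) :=
      closedBall_subset_closedBall' (by rw [mem_ball] at hz; linarith)
    rw [← (hgf z (hsub (mem_closedBall_self (by linarith)))).eq_of_nhds]
    refine h.mean_value hφ hg (by linarith) fun w hw => ?_
    rw [dirac_congr (hgf w (hsub hw))]
    exact hfd w (hRU (closedBall_subset_ball (half_lt_self hR) (hsub hw)))
  exact (hφ.contDiff_integral_smul hg.continuous (by linarith)).contDiffAt.congr_of_eventuallyEq heq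

/-- The derivative in the direction `v`. -/
noncomputable def dirDeriv (v : EuclideanSpace ℝ (Fin n)) (f : EuclideanSpace ℝ (Fin n) → V) :
    EuclideanSpace ℝ (Fin n) → V :=
  fun x => fderiv ℝ f x v

theorem contDiffOn_dirDeriv {f : EuclideanSpace ℝ (Fin n) → V}
    {U : Set (EuclideanSpace ℝ (Fin n))} (hU : IsOpen U) (hf : ContDiffOn ℝ ∞ f U)
    (v : EuclideanSpace ℝ (Fin n)) : ContDiffOn ℝ ∞ (dirDeriv v f) U :=
  (hf.fderiv_of_isOpen hU (by simp)).clm_apply contDiffOn_const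

theorem IsSmoothSolutionOn.dirDeriv {f : EuclideanSpace ℝ (Fin n) → V}
    {U : Set (EuclideanSpace ℝ (Fin n))} (hU : IsOpen U) (h : IsSmoothSolutionOn L f U)
    (v : EuclideanSpace ℝ (Fin n)) : IsSmoothSolutionOn L (dirDeriv v f) U := by
  refine ⟨contDiffOn_dirDeriv hU h.1 v, fun x hx => ?_⟩
  have hx' := hU.mem_nhds hx
  have hf2 : ContDiffAt ℝ ∞ f x := h.1.contDiffAt hx'
  have hd : DifferentiableAt ℝ (fderiv ℝ f) x :=
    (hf2.fderiv_right (m := 1) (by norm_num; norm_cast)).differentiableAt (by simp)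
  have hdv : ∀ v w, fderiv ℝ (fun x => fderiv ℝ f x v) x w = fderiv ℝ (fderiv ℝ f) x w v := by
    intro v w
    rw [fderiv_clm_apply hd (differentiableAt_const v)]
    simp
  have hsymm : ∀ v w, fderiv ℝ (fderiv ℝ f) x w v = fderiv ℝ (fderiv ℝ f) x v w := fun v w =>
    (hf2.isSymmSndFDerivAt (by simp; norm_cast)) w v
  have hzero : (fun z => ∑ s, L s (fderiv ℝ f z (EuclideanSpace.single s 1))) =ᶠ[𝓝 x]
      fun _ => (0 : V) := by
    filter_upwards [hx'] with z hz using h.2 z hz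
  have h1 := hzero.fderiv_eq (𝕜 := ℝ)
  have hdc : ∀ s, DifferentiableAt ℝ (fun z => fderiv ℝ f z (EuclideanSpace.single s 1)) x :=
    fun s => hd.clm_apply (differentiableAt_const _)
  have h2 : HasFDerivAt (fun z => ∑ s, L s (fderiv ℝ f z (EuclideanSpace.single s 1)))
      (∑ s, (L s).comp (fderiv ℝ (fun z => fderiv ℝ f z (EuclideanSpace.single s 1)) x)) x :=
    HasFDerivAt.fun_sum fun s _ => (L s).hasFDerivAt.comp x (hdc s).hasFDerivAt
  rw [h2.fderiv] at h1
  have h3 := congrArg (fun T : EuclideanSpace ℝ (Fin n) →L[ℝ] V => T v) h1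
  simp only [fderiv_fun_const, Pi.zero_apply, zero_apply, sum_apply,
    ContinuousLinearMap.comp_apply, hdv] at h3
  rw [← h3]
  exact Finset.sum_congr rfl fun s _ => congrArg (L s) ((hdv _ _).trans (hsymm _ _))

theorem IsSmoothSolutionOn.iterate_dirDeriv {f : EuclideanSpace ℝ (Fin n) → V}
    {U : Set (EuclideanSpace ℝ (Fin n))} (hU : IsOpen U) (h : IsSmoothSolutionOn L f U)
    (v : EuclideanSpace ℝ (Fin n)) (k : ℕ) :
    IsSmoothSolutionOn L ((Hypercomplex.dirDeriv v)^[k] f) U := by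
  induction k with
  | zero => exact h
  | succ k ih => rw [Function.iterate_succ_apply']; exact ih.dirDeriv hU v

theorem IsConjugateSystem.norm_fderiv_le [CompleteSpace V] (h : IsConjugateSystem L' L)
    {φ : EuclideanSpace ℝ (Fin n) → ℝ} (hφ : IsRadialMollifier φ)
    {f : EuclideanSpace ℝ (Fin n) → V} {x : EuclideanSpace ℝ (Fin n)} {δ K : ℝ} (hδ : 0 < δ)
    (hf : IsSmoothSolutionOn L f (ball x δ)) (hK : ∀ z ∈ ball x δ, ‖f z‖ ≤ K)
    (v : EuclideanSpace ℝ (Fin n)) :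
    ‖fderiv ℝ f x v‖ ≤ 2 * (∫ y, ‖fderiv ℝ φ y‖) * ‖v‖ / δ * K := by
  obtain ⟨g, hg, hgc, hgf⟩ := exists_contDiff_hasCompactSupport_eventuallyEq (k := ⊤)
    (half_pos hδ) (half_lt_self hδ) hf.1
  set r := δ / 2 with hr
  have hr0 : 0 < r := half_pos hδ
  have hsub : closedBall x r ⊆ ball x δ := closedBall_subset_ball (half_lt_self hδ)
  have hdc : Continuous (fderiv ℝ φ) := hφ.contDiff.continuous_fderiv (by simp)
  have hmv : fderiv ℝ f x v = ∫ y, φ y • fderiv ℝ g (x + r • y) v := by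
    rw [← (hgf x (mem_closedBall_self hr0.le)).fderiv_eq]
    refine h.mean_value (f := dirDeriv v g) hφ
      (((contDiffOn_univ.1 (contDiffOn_dirDeriv isOpen_univ hg.contDiffOn v))).of_le (by simp))
      hr0.le fun z hz => ?_
    have hev : dirDeriv v g =ᶠ[𝓝 z] dirDeriv v f :=
      (hgf z hz).fderiv (𝕜 := ℝ) |>.mono fun w hw => by simp only [dirDeriv, hw]
    rw [dirac_congr hev]
    exact (hf.dirDeriv isOpen_ball v).2 z (hsub hz)
  set G : EuclideanSpace ℝ (Fin n) → V := fun y => g (x + r • y) with hG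
  have hGs : ContDiff ℝ 1 G := (hg.of_le (by simp)).comp (by fun_prop)
  have hGd : ∀ y, fderiv ℝ G y v = r • fderiv ℝ g (x + r • y) v := by
    intro y
    have h1 : HasFDerivAt (fun y : EuclideanSpace ℝ (Fin n) => x + r • y)
        (r • ContinuousLinearMap.id ℝ _) y :=
      ((hasFDerivAt_id y).const_smul r).const_add x
    have h3 : fderiv ℝ G y = _ :=
      ((hg.differentiable (by simp) (x + r • y)).hasFDerivAt.comp y h1).fderiv
    rw [h3]
    simp
  have hibp : ∫ y, φ y • fderiv ℝ G y v = -∫ y, fderiv ℝ φ y v • G y := by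
    refine integral_smul_fderiv_eq_neg_fderiv_smul_of_integrable ?_ ?_ ?_
      (fun y _ => hφ.contDiff.differentiable (by simp) y)
      (fun y _ => hGs.differentiable (by simp) y)
    · exact ((hdc.clm_apply continuous_const).smul
        hGs.continuous).integrable_of_hasCompactSupport
        ((hφ.hasCompactSupport.fderiv_apply ℝ v).smul_right)
    · exact (hφ.contDiff.continuous.smul ((hGs.continuous_fderiv (by simp)).clm_apply
        continuous_const)).integrable_of_hasCompactSupport hφ.hasCompactSupport.smul_right
    · exact (hφ.contDiff.continuous.smul hGs.continuous).integrable_of_hasCompactSupport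
        hφ.hasCompactSupport.smul_right
  simp only [hGd, smul_comm _ r, integral_smul] at hibp
  rw [← hmv] at hibp
  have hbound : ‖∫ y, fderiv ℝ φ y v • G y‖ ≤ ∫ y, ‖fderiv ℝ φ y‖ * (‖v‖ * K) := by
    refine norm_integral_le_of_norm_le ?_ (Eventually.of_forall fun y => ?_)
    · exact ((hdc.norm.integrable_of_hasCompactSupport
        (hφ.hasCompactSupport.fderiv ℝ).norm)).mul_const _
    · rw [norm_smul]
      rcases le_or_gt ‖y‖ 1 with hy | hy
      · have hz : x + r • y ∈ closedBall x r := by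
          simp only [mem_closedBall, dist_self_add_left, norm_smul, Real.norm_eq_abs,
            abs_of_pos hr0]
          nlinarith
        have hGK : ‖G y‖ ≤ K := by
          rw [hG]
          simp only
          rw [(hgf _ hz).eq_of_nhds]
          exact hK _ (hsub hz)
        have := (fderiv ℝ φ y).le_opNorm v
        calc ‖fderiv ℝ φ y v‖ * ‖G y‖ ≤ (‖fderiv ℝ φ y‖ * ‖v‖) * K := by gcongr
          _ = _ := by ring
      · have hev : φ =ᶠ[𝓝 y] fun _ => 0 := by
          have : {z : EuclideanSpace ℝ (Fin n) | 1 < ‖z‖} ∈ 𝓝 y :=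
            (isOpen_lt continuous_const continuous_norm).mem_nhds hy
          filter_upwards [this] with z hz using hφ.eq_zero z hz.le
        rw [hev.fderiv_eq]
        simp
  rw [integral_mul_const] at hbound
  rw [← norm_neg, ← hibp, norm_smul, Real.norm_eq_abs, abs_of_pos hr0] at hbound
  have : ‖fderiv ℝ f x v‖ ≤ ((∫ y, ‖fderiv ℝ φ y‖) * (‖v‖ * K)) / r := by
    rw [le_div_iff₀ hr0]; linarith
  refine this.trans (le_of_eq ?_)
  rw [hr]; field_simp

theorem IsConjugateSystem.norm_iterate_dirDeriv_le [CompleteSpace V] (h : IsConjugateSystem L' L)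
    {φ : EuclideanSpace ℝ (Fin n) → ℝ} (hφ : IsRadialMollifier φ)
    {f : EuclideanSpace ℝ (Fin n) → V} {U : Set (EuclideanSpace ℝ (Fin n))} (hU : IsOpen U)
    {δ K : ℝ} (hδ : 0 < δ) (hf : IsSmoothSolutionOn L f U) (hK : ∀ z ∈ U, ‖f z‖ ≤ K)
    (v : EuclideanSpace ℝ (Fin n)) (k : ℕ) :
    ∀ x ∈ U, ball x (k * δ) ⊆ U →
      ‖(dirDeriv v)^[k] f x‖ ≤ (2 * (∫ y, ‖fderiv ℝ φ y‖) * ‖v‖ / δ) ^ k * K := by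
  induction k with
  | zero => intro x hx _; simpa using hK x hx
  | succ k ih =>
    intro x hx hball
    have hsub : ball x δ ⊆ U := (ball_subset_ball (by push_cast; nlinarith [k.cast_nonneg (α := ℝ)])).trans hball
    rw [Function.iterate_succ_apply', pow_succ', mul_assoc]
    refine h.norm_fderiv_le hφ hδ ((hf.iterate_dirDeriv hU v k).mono hsub) (fun z hz => ?_) v
    refine ih z (hsub hz) (Subset.trans (ball_subset_ball' ?_) hball)
    rw [mem_ball] at hz
    push_cast
    linarith

end Regularity

section UniqueContinuation

variable {n : ℕ} {V : Type*} [NormedAddCommGroup V] [NormedSpace ℝ V]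
  {L L' : Fin n → V →L[ℝ] V}

theorem iteratedDerivWithin_comp_line {f : EuclideanSpace ℝ (Fin n) → V}
    {U : Set (EuclideanSpace ℝ (Fin n))} (hU : IsOpen U) (hf : IsSmoothSolutionOn L f U)
    {x w : EuclideanSpace ℝ (Fin n)} (hw : ∀ t ∈ Icc (0 : ℝ) 1, x + t • w ∈ U) (k : ℕ) :
    ∀ t ∈ Icc (0 : ℝ) 1, iteratedDerivWithin k (fun t : ℝ => f (x + t • w)) (Icc 0 1) t =
      (dirDeriv w)^[k] f (x + t • w) := by
  induction k with
  | zero => intro t _; simp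
  | succ k ih =>
    intro t ht
    rw [iteratedDerivWithin_succ, Function.iterate_succ_apply',
      derivWithin_congr ih (ih t ht)]
    have h1 : HasDerivAt (fun t : ℝ => x + t • w) w t := by
      simpa using ((hasDerivAt_id t).smul_const w).const_add x
    have h2 : DifferentiableAt ℝ ((dirDeriv w)^[k] f) (x + t • w) :=
      ((hf.iterate_dirDeriv hU w k).1.contDiffAt (hU.mem_nhds (hw t ht))).differentiableAt (by simp)
    exact ((h2.hasFDerivAt.comp_hasDerivAt t h1).hasDerivWithinAt).derivWithin
      (uniqueDiffOn_Icc one_pos t ht)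

theorem add_one_pow_div_factorial_le (k : ℕ) :
    ((k : ℝ) + 1) ^ (k + 1) / (k.factorial : ℝ) ≤ ((k + 1 : ℕ) : ℝ) * Real.exp 1 ^ (k + 1) := by
  have h := Real.pow_div_factorial_le_exp ((k : ℝ) + 1) (by positivity) (k + 1)
  have he : Real.exp ((k : ℝ) + 1) = Real.exp 1 ^ (k + 1) := by
    rw [← Real.exp_nat_mul]; push_cast; ring_nf
  rw [he, Nat.factorial_succ] at h
  have hk : (0 : ℝ) < (k.factorial : ℝ) := by positivity
  push_cast at h ⊢
  rw [div_le_iff₀ (by positivity)] at h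
  rw [div_le_iff₀ hk]
  linarith

/-- A solution all of whose derivatives vanish at a point vanishes near that point. -/
theorem IsConjugateSystem.eventuallyEq_zero [CompleteSpace V] (h : IsConjugateSystem L' L)
    {f : EuclideanSpace ℝ (Fin n) → V} {U : Set (EuclideanSpace ℝ (Fin n))} (hU : IsOpen U)
    (hf : IsSmoothSolutionOn L f U) {x : EuclideanSpace ℝ (Fin n)} (hx : x ∈ U)
    (hzero : ∀ w k, (dirDeriv w)^[k] f x = 0) : f =ᶠ[𝓝 x] 0 := by
  obtain ⟨φ, hφ⟩ := exists_isRadialMollifier n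
  obtain ⟨R, hR, hRU⟩ := nhds_basis_closedBall.mem_iff.1 (hU.mem_nhds hx)
  obtain ⟨K, hK⟩ := (isCompact_closedBall x R).exists_bound_of_continuousOn
    (hf.1.continuousOn.mono hRU)
  have hf' : IsSmoothSolutionOn L f (ball x R) := hf.mono (ball_subset_closedBall.trans hRU)
  have hK' : ∀ z ∈ ball x R, ‖f z‖ ≤ K := fun z hz => hK z (ball_subset_closedBall hz)
  set C := 2 * (∫ y, ‖fderiv ℝ φ y‖) with hC
  have hC0 : 0 ≤ C := by
    have : 0 ≤ ∫ y, ‖fderiv ℝ φ y‖ := integral_nonneg fun y => norm_nonneg _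
    positivity
  have hev : ∀ᶠ z in 𝓝 x, C * ‖z - x‖ * 2 / R * Real.exp 1 < 1 := by
    have hc : Continuous fun z : EuclideanSpace ℝ (Fin n) =>
      C * ‖z - x‖ * 2 / R * Real.exp 1 := by fun_prop
    refine hc.continuousAt.eventually_lt continuousAt_const ?_
    simp
  filter_upwards [hev, ball_mem_nhds x (half_pos hR)] with z hz hzR
  set w := z - x with hw
  set a := C * ‖w‖ * 2 / R with ha
  have ha0 : 0 ≤ a := by positivity
  have hwR : ‖w‖ < R / 2 := by rwa [mem_ball, dist_eq_norm] at hzR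
  have hmem : ∀ t ∈ Icc (0 : ℝ) 1, x + t • w ∈ ball x (R / 2) := by
    intro t ht
    simp only [mem_ball, dist_self_add_left, norm_smul, Real.norm_eq_abs, abs_of_nonneg ht.1]
    nlinarith [ht.1, ht.2, norm_nonneg w]
  have hmem' : ∀ t ∈ Icc (0 : ℝ) 1, x + t • w ∈ ball x R := fun t ht =>
    ball_subset_ball (by linarith) (hmem t ht)
  have hit := iteratedDerivWithin_comp_line isOpen_ball hf' hmem'
  have hcd : ContDiffOn ℝ ∞ (fun t : ℝ => f (x + t • w)) (Icc 0 1) :=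
    hf'.1.comp (by fun_prop) fun t ht => hmem' t ht
  have hbound : ∀ k : ℕ, ‖f z‖ ≤ ((k + 1 : ℕ) : ℝ) * (a * Real.exp 1) ^ (k + 1) * K := by
    intro k
    have hδ : 0 < R / (2 * ((k + 1 : ℕ) : ℝ)) := by positivity
    have hT := taylor_mean_remainder_bound (n := k) (C := (a * (k + 1)) ^ (k + 1) * K)
      zero_le_one (hcd.of_le (by norm_cast; exact le_top)) (right_mem_Icc.2 zero_le_one) (by
        intro t ht
        rw [hit _ t ht]
        have hb := h.norm_iterate_dirDeriv_le hφ isOpen_ball hδ hf' hK' w (k + 1)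
          (x + t • w) (hmem' t ht) (by
            have : ((k + 1 : ℕ) : ℝ) * (R / (2 * ((k + 1 : ℕ) : ℝ))) = R / 2 := by field_simp
            rw [this]
            refine ball_subset_ball' ?_
            have := hmem t ht
            rw [mem_ball] at this
            linarith)
        refine hb.trans (le_of_eq ?_)
        rw [← hC, ha]
        congr 2
        push_cast
        field_simp)
    have hT0 : taylorWithinEval (fun t : ℝ => f (x + t • w)) k (Icc 0 1) 0 1 = 0 := by
      rw [taylor_within_apply]
      refine Finset.sum_eq_zero fun j _ => ?_
      rw [hit j 0 (left_mem_Icc.2 zero_le_one), zero_smul, add_zero, hzero, smul_zero]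
    have hxz : x + (1 : ℝ) • w = z := by rw [hw, one_smul]; abel
    have hK0 : 0 ≤ K := (norm_nonneg _).trans (hK x (mem_closedBall_self hR.le))
    rw [hT0, sub_zero, sub_zero, one_pow, mul_one, hxz] at hT
    calc ‖f z‖ ≤ (a * (k + 1)) ^ (k + 1) * K / k.factorial := hT
      _ = a ^ (k + 1) * (((k : ℝ) + 1) ^ (k + 1) / k.factorial) * K := by rw [mul_pow]; ring
      _ ≤ a ^ (k + 1) * (((k + 1 : ℕ) : ℝ) * Real.exp 1 ^ (k + 1)) * K := by
          gcongr
          exact add_one_pow_div_factorial_le k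
      _ = _ := by rw [mul_pow]; ring
  have hlim : Tendsto (fun k : ℕ => ((k + 1 : ℕ) : ℝ) * (a * Real.exp 1) ^ (k + 1) * K) atTop
      (𝓝 (0 * K)) :=
    ((tendsto_self_mul_const_pow_of_lt_one (by positivity) hz).comp
      (tendsto_add_atTop_nat 1)).mul_const K
  rw [zero_mul] at hlim
  exact norm_le_zero_iff.1 (ge_of_tendsto' hlim hbound)

theorem iterate_dirDeriv_eventuallyEq_zero {f : EuclideanSpace ℝ (Fin n) → V}
    {x : EuclideanSpace ℝ (Fin n)} (hf : f =ᶠ[𝓝 x] 0) (w : EuclideanSpace ℝ (Fin n)) (k : ℕ) :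
    (dirDeriv w)^[k] f =ᶠ[𝓝 x] 0 := by
  induction k with
  | zero => exact hf
  | succ k ih =>
    rw [Function.iterate_succ_apply']
    filter_upwards [ih.fderiv (𝕜 := ℝ)] with z hz
    simp [dirDeriv, hz]

/-- The identity theorem: a solution on a connected open set vanishes identically if all its
derivatives vanish at one point. -/
theorem IsConjugateSystem.eqOn_zero [CompleteSpace V] (h : IsConjugateSystem L' L)
    {f : EuclideanSpace ℝ (Fin n) → V} {U : Set (EuclideanSpace ℝ (Fin n))} (hU : IsOpen U)
    (hUc : IsPreconnected U) (hf : IsSmoothSolutionOn L f U) {x : EuclideanSpace ℝ (Fin n)}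
    (hx : x ∈ U) (hzero : ∀ w k, (dirDeriv w)^[k] f x = 0) : ∀ z ∈ U, f z = 0 := by
  have hsub : U ⊆ {z | f =ᶠ[𝓝 z] 0} := by
    refine hUc.subset_of_closure_inter_subset isOpen_setOfPred_eventually_nhds
      ⟨x, hx, h.eventuallyEq_zero hU hf hx hzero⟩ ?_
    rintro z ⟨hzc, hzU⟩
    refine h.eventuallyEq_zero hU hf hzU fun w k => ?_
    by_contra hne
    have hc : ContinuousAt ((dirDeriv w)^[k] f) z :=
      ((hf.iterate_dirDeriv hU w k).1.contDiffAt (hU.mem_nhds hzU)).continuousAt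
    obtain ⟨y, hy, hy'⟩ := ((mem_closure_iff_frequently.1 hzc).and_eventually
      (hc.eventually_ne hne)).exists
    exact hy' (iterate_dirDeriv_eventuallyEq_zero hy w k).eq_of_nhds
  exact fun z hz => (hsub hz).eq_of_nhds

end UniqueContinuation

section Hypersurface

variable {m : ℕ} {V : Type*} [NormedAddCommGroup V] [NormedSpace ℝ V]
  {L L' : Fin (m + 1) → V →L[ℝ] V}

/-- A solution whose derivative vanishes on a hyperplane has vanishing derivative. -/
theorem IsConjugateSystem.fderiv_eq_zero (h : IsConjugateSystem L' L)
    {f : EuclideanSpace ℝ (Fin (m + 1)) → V} {x : EuclideanSpace ℝ (Fin (m + 1))}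
    (hf : dirac L f x = 0)
    {J : EuclideanSpace ℝ (Fin m) →ₗ[ℝ] EuclideanSpace ℝ (Fin (m + 1))}
    (hJ : Function.Injective J) (hfJ : ∀ v, fderiv ℝ f x (J v) = 0) : fderiv ℝ f x = 0 := by
  set S := LinearMap.range J with hS
  have hdim : Module.finrank ℝ Sᗮ = 1 := by
    have h1 := S.finrank_add_finrank_orthogonal
    have h2 : Module.finrank ℝ S = m := by
      rw [hS, LinearMap.finrank_range_of_inj hJ, finrank_euclideanSpace_fin]
    rw [h2, finrank_euclideanSpace_fin] at h1
    omega
  obtain ⟨⟨ν, hν⟩, hν0, hspan⟩ := finrank_eq_one_iff'.1 hdim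
  have hν0' : ν ≠ 0 := fun h0 => hν0 (Subtype.ext h0)
  have hdec : ∀ w, ∃ c : ℝ, fderiv ℝ f x w = c • fderiv ℝ f x ν ∧ inner ℝ ν w = c * ‖ν‖ ^ 2 := by
    intro w
    obtain ⟨s, hs, s', hs', rfl⟩ := S.exists_add_mem_mem_orthogonal w
    obtain ⟨c, hc⟩ := hspan ⟨s', hs'⟩
    have hc' : c • ν = s' := congrArg Subtype.val hc
    obtain ⟨v, rfl⟩ := hs
    refine ⟨c, ?_, ?_⟩
    · rw [map_add, hfJ, zero_add, ← hc', map_smul]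
    · rw [inner_add_right, S.inner_left_of_mem_orthogonal ⟨v, rfl⟩ hν, ← hc', inner_smul_right,
        real_inner_self_eq_norm_sq, zero_add]
  have hn : ‖ν‖ ^ 2 ≠ 0 := pow_ne_zero 2 (norm_ne_zero_iff.2 hν0')
  have hpart : ∀ s, fderiv ℝ f x (EuclideanSpace.single s 1) =
      (ν s * (‖ν‖ ^ 2)⁻¹) • fderiv ℝ f x ν := by
    intro s
    obtain ⟨c, h1, h2⟩ := hdec (EuclideanSpace.single s 1)
    rw [h1]
    congr 1
    simp only [EuclideanSpace.inner_single_right, one_mul, conj_trivial] at h2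
    rw [h2, mul_assoc, mul_inv_cancel₀ hn, mul_one]
  have hν1 : fderiv ℝ f x ν = 0 := by
    rw [h.radial_eq hf ν]
    refine smul_eq_zero_of_right _ (Finset.sum_eq_zero fun s _ => Finset.sum_eq_zero fun t _ => ?_)
    rw [hpart, hpart, smul_smul, smul_smul, ← sub_smul]
    rw [show ν t * (ν s * (‖ν‖ ^ 2)⁻¹) - ν s * (ν t * (‖ν‖ ^ 2)⁻¹) = 0 by ring]
    simp
  ext1 w
  obtain ⟨c, h1, -⟩ := hdec w
  rw [h1, hν1, smul_zero]
  rfl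

/-- All derivatives of a solution vanish along a hypersurface on which the solution vanishes. -/
theorem IsConjugateSystem.iterate_dirDeriv_eq_zero (h : IsConjugateSystem L' L)
    {f : EuclideanSpace ℝ (Fin (m + 1)) → V} {U : Set (EuclideanSpace ℝ (Fin (m + 1)))}
    (hU : IsOpen U) (hf : IsSmoothSolutionOn L f U)
    {N : Type*} [TopologicalSpace N] [ChartedSpace (EuclideanSpace ℝ (Fin m)) N]
    {j : N → EuclideanSpace ℝ (Fin (m + 1))} (hj : MDifferentiable (𝓡 m) (𝓡 (m + 1)) j)
    (hji : ∀ p, Function.Injective (mfderiv (𝓡 m) (𝓡 (m + 1)) j p)) (hjU : ∀ p, j p ∈ U)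
    (hfj : ∀ p, f (j p) = 0) (w : EuclideanSpace ℝ (Fin (m + 1))) (k : ℕ) :
    ∀ p, (dirDeriv w)^[k] f (j p) = 0 := by
  induction k with
  | zero => exact hfj
  | succ k ih =>
    intro p
    have hg := hf.iterate_dirDeriv hU w k
    rw [Function.iterate_succ_apply']
    set g := (dirDeriv w)^[k] f with hgdef
    have hd : DifferentiableAt ℝ g (j p) :=
      (hg.1.contDiffAt (hU.mem_nhds (hjU p))).differentiableAt (by simp)
    have hcomp := mfderiv_comp (I := 𝓡 m) (I' := 𝓡 (m + 1)) (I'' := 𝓘(ℝ, V)) p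
      hd.mdifferentiableAt (hj p)
    have hconst : g ∘ j = fun _ => (0 : V) := funext ih
    rw [hconst, mfderiv_const, mfderiv_eq_fderiv] at hcomp
    have hzero : fderiv ℝ g (j p) = 0 := by
      refine h.fderiv_eq_zero (hg.2 _ (hjU p)) (J := (mfderiv (𝓡 m) (𝓡 (m + 1)) j p).toLinearMap)
        (hji p) fun v => ?_
      exact (DFunLike.congr_fun hcomp v).symm
    rw [dirDeriv, hzero]
    rfl

theorem IsConjugateSystem.eqOn_zero_of_hypersurface [CompleteSpace V] (h : IsConjugateSystem L' L)
    {f : EuclideanSpace ℝ (Fin (m + 1)) → V} {U : Set (EuclideanSpace ℝ (Fin (m + 1)))}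
    (hU : IsOpen U) (hUc : IsPreconnected U) (hf : ContDiffOn ℝ 1 f U)
    (hfd : ∀ x ∈ U, dirac L f x = 0)
    {N : Type*} [TopologicalSpace N] [ChartedSpace (EuclideanSpace ℝ (Fin m)) N] [Nonempty N]
    {j : N → EuclideanSpace ℝ (Fin (m + 1))} (hj : MDifferentiable (𝓡 m) (𝓡 (m + 1)) j)
    (hji : ∀ p, Function.Injective (mfderiv (𝓡 m) (𝓡 (m + 1)) j p)) (hjU : ∀ p, j p ∈ U)
    (hfj : ∀ p, f (j p) = 0) : ∀ z ∈ U, f z = 0 := by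
  have hs := h.isSmoothSolutionOn hU hf hfd
  obtain ⟨p⟩ := ‹Nonempty N›
  exact h.eqOn_zero hU hUc hs (hjU p) fun w k =>
    h.iterate_dirDeriv_eq_zero hU hs hj hji hjU hfj w k p

end Hypersurface

section Coordinates

variable {A : Type*} [NonAssocRing A]

theorem IsAlternative.mul_mul_self (hA : IsAlternative A) (a b : A) : a * (a * b) = a * a * b := by
  have := (hA a b).1
  rw [associator_apply, sub_eq_zero] at this
  exact this.symm

theorem IsAlternative.mul_mul_add_mul_mul (hA : IsAlternative A) (a b c : A) :
    a * (b * c) + b * (a * c) = (a * b + b * a) * c := by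
  have h := hA.mul_mul_self (a + b) c
  simp only [add_mul, mul_add] at h ⊢
  rw [hA.mul_mul_self a c, hA.mul_mul_self b c] at h
  have h2 : (a * (b * c) + b * (a * c)) + (a * a * c + b * b * c) =
      (a * b * c + b * a * c) + (a * a * c + b * b * c) := by
    calc _ = a * a * c + b * (a * c) + (a * (b * c) + b * b * c) := by abel
      _ = _ := h
      _ = _ := by abel
  exact add_right_cancel h2

theorem mul_self_eq_neg_one_of_mem_imaginaryUnits [StarRing A] {v : A}
    (hv : v ∈ imaginaryUnits A) : v * v = -1 := by
  have h1 : v + star v = 0 := hv.1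
  have h2 : v * star v = 1 := hv.2
  rw [eq_neg_of_add_eq_zero_right h1, mul_neg] at h2
  rw [← h2, neg_neg]

variable [Module ℝ A] {M : Submodule ℝ A} {m d : ℕ}

section Multiplication

variable [SMulCommClass ℝ A A]

/-- Left multiplication by `v_s` in the coordinates given by the basis `B'`. -/
noncomputable def mulLeftCoord (B : Module.Basis (Fin (m + 1)) ℝ M)
    (B' : Module.Basis (Fin (d + 1)) ℝ A) (s : Fin (m + 1)) :
    (Fin (d + 1) → ℝ) →L[ℝ] (Fin (d + 1) → ℝ) :=
  (B'.equivFun.toLinearMap ∘ₗ LinearMap.mulLeft ℝ (B s : A) ∘ₗ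
    B'.equivFun.symm.toLinearMap).toContinuousLinearMap

theorem mulLeftCoord_apply (B : Module.Basis (Fin (m + 1)) ℝ M)
    (B' : Module.Basis (Fin (d + 1)) ℝ A) (s : Fin (m + 1)) (a : Fin (d + 1) → ℝ) :
    mulLeftCoord B B' s a = B'.equivFun ((B s : A) * B'.equivFun.symm a) := rfl

/-- Left multiplication by the conjugate of `v_s` in the coordinates given by `B'`. -/
noncomputable def mulLeftConjCoord (B : Module.Basis (Fin (m + 1)) ℝ M)
    (B' : Module.Basis (Fin (d + 1)) ℝ A) (s : Fin (m + 1)) :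
    (Fin (d + 1) → ℝ) →L[ℝ] (Fin (d + 1) → ℝ) :=
  if s = 0 then mulLeftCoord B B' s else -mulLeftCoord B B' s

theorem isConjugateSystem_mulLeftCoord [StarRing A] (hA : IsAlternative A)
    {B : Module.Basis (Fin (m + 1)) ℝ M} (hB : IsHypercomplexBasis B)
    (B' : Module.Basis (Fin (d + 1)) ℝ A) :
    IsConjugateSystem (mulLeftConjCoord B B') (mulLeftCoord B B') := by
  have h0 : ∀ a, mulLeftCoord B B' 0 a = a := fun a => by
    rw [mulLeftCoord_apply, hB.zero_eq_one, one_mul, LinearEquiv.apply_symm_apply]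
  have hadd : ∀ s t a, mulLeftCoord B B' s (mulLeftCoord B B' t a) +
      mulLeftCoord B B' t (mulLeftCoord B B' s a) =
      B'.equivFun (((B s : A) * B t + B t * B s) * B'.equivFun.symm a) := fun s t a => by
    simp only [mulLeftCoord_apply, LinearEquiv.symm_apply_apply]
    rw [← map_add, hA.mul_mul_add_mul_mul]
  intro s t a
  by_cases hs : s = 0
  · subst hs
    by_cases ht : t = 0
    · subst ht
      simp [mulLeftConjCoord, h0, two_smul]
    · simp [mulLeftConjCoord, h0, ht, Ne.symm ht]
  · by_cases ht : t = 0
    · subst ht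
      simp [mulLeftConjCoord, h0, hs]
    · have h1 : mulLeftConjCoord B B' s (mulLeftCoord B B' t a) +
          mulLeftConjCoord B B' t (mulLeftCoord B B' s a) =
          -(B'.equivFun (((B s : A) * B t + B t * B s) * B'.equivFun.symm a)) := by
        rw [← hadd]
        simp only [mulLeftConjCoord, hs, ht, if_false, neg_apply]
        abel
      rw [h1]
      split_ifs with hst
      · subst hst
        rw [mul_self_eq_neg_one_of_mem_imaginaryUnits (hB.mem_imaginaryUnits s hs), add_mul,
          neg_one_mul, map_add, map_neg, LinearEquiv.apply_symm_apply, two_smul]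
        abel
      · rw [hB.anticomm s t hs ht hst, neg_add_cancel, zero_mul, map_zero, neg_zero]

end Multiplication

/-- The function `ℝ^{m+1} → ℝ^{d+1}` that represents `f` in coordinates. -/
noncomputable def coordFun (B : Module.Basis (Fin (m + 1)) ℝ M)
    (B' : Module.Basis (Fin (d + 1)) ℝ A) (f : M → A) (x : EuclideanSpace ℝ (Fin (m + 1))) :
    Fin (d + 1) → ℝ :=
  B'.equivFun (f (identification B x))

theorem identification_single (B : Module.Basis (Fin (m + 1)) ℝ M) (s : Fin (m + 1)) :
    identification B (EuclideanSpace.single s 1) = B s := by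
  simp [identification]

theorem IsC1On.contDiffOn {B : Module.Basis (Fin (m + 1)) ℝ M}
    {B' : Module.Basis (Fin (d + 1)) ℝ A} {f : M → A} {Ω : Set M} (hf : IsC1On B B' f Ω) :
    ContDiffOn ℝ 1 (coordFun B B' f) (identification B ⁻¹' Ω) :=
  contDiffOn_pi.2 fun t => hf t

theorem isOpen_preimage_identification [TopologicalSpace A] [IsTopologicalAddGroup A]
    [ContinuousSMul ℝ A] [T2Space A] (B : Module.Basis (Fin (m + 1)) ℝ M) {Ω : Set M}
    (hΩ : IsOpen Ω) : IsOpen (identification B ⁻¹' Ω) :=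
  hΩ.preimage (identification B).toLinearMap.continuous_of_finiteDimensional

theorem isPreconnected_preimage_identification [TopologicalSpace A] [IsTopologicalAddGroup A]
    [ContinuousSMul ℝ A] [T2Space A] (B : Module.Basis (Fin (m + 1)) ℝ M) {Ω : Set M}
    (hΩ : IsPreconnected Ω) : IsPreconnected (identification B ⁻¹' Ω) :=
  (identification B).toContinuousLinearEquiv.toHomeomorph.isPreconnected_preimage.2 hΩ

theorem dirac_coordFun [SMulCommClass ℝ A A] {B : Module.Basis (Fin (m + 1)) ℝ M}
    {B' : Module.Basis (Fin (d + 1)) ℝ A} {f : M → A} {x : EuclideanSpace ℝ (Fin (m + 1))}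
    (hf : DifferentiableAt ℝ (coordFun B B' f) x) :
    dirac (mulLeftCoord B B') (coordFun B B' f) x =
      B'.equivFun (cauchyRiemann B B' f (identification B x)) := by
  have hpart : ∀ s, B'.equivFun.symm (fderiv ℝ (coordFun B B' f) x (EuclideanSpace.single s 1)) =
      partialDeriv B B' s f (identification B x) := by
    intro s
    rw [B'.equivFun_symm_apply, partialDeriv]
    refine Finset.sum_congr rfl fun t _ => ?_
    congr 1
    have h1 : HasFDerivAt (fun y => coordFun B B' f y t)
        ((ContinuousLinearMap.proj t).comp (fderiv ℝ (coordFun B B' f) x)) x :=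
      hasFDerivAt_pi'.1 hf.hasFDerivAt t
    have h2 := (h1.hasLineDerivAt (EuclideanSpace.single s 1)).lineDeriv
    rw [lineDeriv] at h2 ⊢
    simp only [coordFun, map_add, map_smul, identification_single] at h2
    exact h2.symm
  rw [dirac, cauchyRiemann, map_sum]
  exact Finset.sum_congr rfl fun s _ => by rw [mulLeftCoord_apply, hpart]

theorem dirac_sub {n : ℕ} {V : Type*} [NormedAddCommGroup V] [NormedSpace ℝ V]
    {L : Fin n → V →L[ℝ] V} {f g : EuclideanSpace ℝ (Fin n) → V} {x : EuclideanSpace ℝ (Fin n)}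
    (hf : DifferentiableAt ℝ f x) (hg : DifferentiableAt ℝ g x) :
    dirac L (f - g) x = dirac L f x - dirac L g x := by
  simp only [dirac, fderiv_sub hf hg, sub_apply, map_sub, Finset.sum_sub_distrib]

end Coordinates

end Hypercomplex

theorem mainTheorem3
    {A : Type*} [NonAssocRing A] [Module ℝ A] [IsScalarTower ℝ A A] [SMulCommClass ℝ A A]
    [StarRing A] [StarModule ℝ A]
    -- the natural (unique Hausdorff vector space) topology of the finite-dimensional space `A`
    [TopologicalSpace A] [IsTopologicalAddGroup A] [ContinuousSMul ℝ A] [T2Space A]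
    (hA : Hypercomplex.IsAlternative A)
    -- the hypercomplex subspace, its hypercomplex basis, and the completion to a basis of `A`
    {m d : ℕ} (hmd : m ≤ d)
    (M : Submodule ℝ A) (hM : Hypercomplex.IsHypercomplexSubspace M)
    (B : Module.Basis (Fin (m + 1)) ℝ M) (hB : Hypercomplex.IsHypercomplexBasis B)
    (B' : Module.Basis (Fin (d + 1)) ℝ A)
    (hB' : ∀ s : Fin (m + 1), B' (Fin.castLE (Nat.succ_le_succ hmd) s) = (B s : A))
    -- the domain
    (Ω : Set M) (hΩ : IsOpen Ω) (hΩc : IsConnected Ω)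
    -- the non-empty `m`-dimensional smooth submanifold of `Ω`
    {N : Type*} [TopologicalSpace N] [ChartedSpace (EuclideanSpace ℝ (Fin m)) N]
    [IsManifold (𝓡 m) ∞ N] [Nonempty N]
    (ι : N → M) (hι : Hypercomplex.IsSmoothImmersion B m ι) (hιΩ : Set.range ι ⊆ Ω) :
    (∀ f g : M → A, Hypercomplex.IsLeftMonogenicOn B B' f Ω →
        Hypercomplex.IsLeftMonogenicOn B B' g Ω →
        Set.EqOn f g (Set.range ι) → Set.EqOn f g Ω) ∧
    (∀ f : M → A, Hypercomplex.IsLeftMonogenicOn B B' f Ω →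
        Set.range ι ⊆ Hypercomplex.zeroSet f Ω → ∀ x ∈ Ω, f x = 0) := by
  have hconj := Hypercomplex.isConjugateSystem_mulLeftCoord hA hB B'
  have hU := Hypercomplex.isOpen_preimage_identification B hΩ
  have hUc := Hypercomplex.isPreconnected_preimage_identification B hΩc.isPreconnected
  have hdiff : ∀ f : M → A, Hypercomplex.IsLeftMonogenicOn B B' f Ω →
      ∀ x ∈ Hypercomplex.identification B ⁻¹' Ω,
        DifferentiableAt ℝ (Hypercomplex.coordFun B B' f) x := fun f hf x hx =>
    (hf.1.contDiffOn.contDiffAt (hU.mem_nhds hx)).differentiableAt (by simp)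
  have hdirac : ∀ f : M → A, Hypercomplex.IsLeftMonogenicOn B B' f Ω →
      ∀ x ∈ Hypercomplex.identification B ⁻¹' Ω,
        Hypercomplex.dirac (Hypercomplex.mulLeftCoord B B') (Hypercomplex.coordFun B B' f) x = 0 :=
    fun f hf x hx => by
      rw [Hypercomplex.dirac_coordFun (hdiff f hf x hx), hf.2 _ hx, map_zero]
  have key : ∀ F : EuclideanSpace ℝ (Fin (m + 1)) → Fin (d + 1) → ℝ,
      ContDiffOn ℝ 1 F (Hypercomplex.identification B ⁻¹' Ω) →
      (∀ x ∈ Hypercomplex.identification B ⁻¹' Ω,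
        Hypercomplex.dirac (Hypercomplex.mulLeftCoord B B') F x = 0) →
      (∀ p, F ((Hypercomplex.identification B).symm (ι p)) = 0) →
      ∀ x ∈ Ω, F ((Hypercomplex.identification B).symm x) = 0 := by
    intro F hF hFd hF0 x hx
    refine hconj.eqOn_zero_of_hypersurface hU hUc hF hFd (hι.contMDiff.mdifferentiable (by simp))
      hι.injective_mfderiv (fun p => ?_) hF0 _ ?_
    · simpa using hιΩ (Set.mem_range_self p)
    · simpa using hx
  refine ⟨fun f g hf hg hfg x hx => ?_, fun f hf hz x hx => ?_⟩
  · have h := key (Hypercomplex.coordFun B B' f - Hypercomplex.coordFun B B' g)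
      (hf.1.contDiffOn.sub hg.1.contDiffOn)
      (fun y hy => by
        rw [Hypercomplex.dirac_sub (hdiff f hf y hy) (hdiff g hg y hy), hdirac f hf y hy,
          hdirac g hg y hy, sub_zero])
      (fun p => by
        simp [Hypercomplex.coordFun, hfg (Set.mem_range_self p)]) x hx
    rw [Pi.sub_apply, sub_eq_zero] at h
    simpa only [Hypercomplex.coordFun, LinearEquiv.apply_symm_apply,
      EmbeddingLike.apply_eq_iff_eq] using h
  · have h := key (Hypercomplex.coordFun B B' f) hf.1.contDiffOn (hdirac f hf)
      (fun p => by
        rw [Hypercomplex.coordFun, LinearEquiv.apply_symm_apply, (hz (Set.mem_range_self p)).2,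
          map_zero]) x hx
    rwa [Hypercomplex.coordFun, LinearEquiv.apply_symm_apply, LinearEquiv.map_eq_zero_iff] at h
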